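/- Let $M=\bigoplus_{i\ge 0}\mathbb Z\,b_i$ and, for $i,j\ge 0$, let $\mathcal E_{ij}\in\mathrm{End}_{\mathbb Z}(M)$ be given by $\mathcal E_{ij}b_k=\delta_{jk}b_i$. For $A\in\mathrm{End}_{\mathbb Z}(M)$ let $\delta(A)$ be the unique derivation of the exterior algebra $\bigwedge M$ (so $\delta(A)(u\wedge v)=\delta(A)u\wedge v+u\wedge\delta(A)v$) with $\delta(A)_{|M}=A$; it preserves each $\bigwedge^rM$. Fix an integer $r\ge 1$. Let $B_r=\mathbb Z[e_1,\dots,e_r]$, $E_r(z)=1-e_1z+\dots+(-1)^re_rz^r$, and let $(h_j)_{j\in\mathbb Z}$ be defined by $\sum_{j\ge 0}h_jz^j=1/E_r(z)$ and $h_j=0$ for $j<0$. For a partition $\lambda=(\lambda_1\ge\dots\ge\lambda_r\ge 0)$ put $$\Delta_\lambda(H_r)=\det(h_{\lambda_j-j+i})_{1\le i,j\le r}\in B_r,\qquad [\mathbf b]^r_\lambda=b_{r-1+\lambda_1}\wedge b_{r-2+\lambda_2}\wedge\dots\wedge b_{\lambda_r}\in\textstyle\bigwedge^rM .$$ Let $\phi_r:B_r\to\bigwedge^rM$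 be the $\mathbb Z$-module isomorphism with $\phi_r(\Delta_\lambda(H_r))=[\mathbf b]^r_\lambda$ for all such $\lambda$. Let $\mathcal E_{ij}$ act on $B_r$ by $\phi_r(\mathcal E_{ij}P)=\delta(\mathcal E_{ij})\phi_r(P)$, and put $\mathcal E(z,w)P=\sum_{i,j\ge 0}(\mathcal E_{ij}P)\,z^iw^{-j}$ (for fixed $i$ and $P$ only finitely many $j$ contribute). Let $\overline\sigma_-(z):\bigwedge M\to\bigwedge M[z^{-1}]$ be the multiplicative ($\mathbb Z$-algebra) map with $b_j\mapsto b_j-b_{j-1}z^{-1}$ (where $b_{-1}=0$), i.e. the inverse of the Hasse–Schmidt derivation $\sigma_-(z)$ with $\sigma_-(z)b_j=\sum_{i=0}^{j}b_{j-i}z^{-i}$. Denote by the same symbol the map $B_r\to B_r[z^{-1}]$ obtained by applying $\phi_r$, then $\overline\sigma_-(z)$, then $\phi_r^{-1}$ to each coefficient, and extend it to $B_r[w,w^{-1}]$ by acting on each coefficient of a power of $w$. Let $\Delta_\lambda(w^{-\lambda},H_r)$ be the determinant of the $r\times r$ matrix whose first row is $(w^{j-1-\lambda_j})_{1\le j\le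 r}$ and whose entry in row $i\ge 2$ and column $j$ is $h_{\lambda_j-j+i}$. Let $\Delta_\lambda(w^{-\lambda},\overline\sigma_-(z)H_r)$ be the determinant of the matrix with the same first row and with entry $h_{\lambda_j-j+i}-h_{\lambda_j-j+i-1}/z$ in row $i\ge 2$ and column $j$. **Theorem.** For every partition $\lambda$ of length at most $r$, in the ring $B_r[w,w^{-1}]((z))$, $$\mathcal E(z,w)\Delta_\lambda(H_r)=\frac{z^{r-1}}{w^{r-1}}\,\frac1{E_r(z)}\,\overline\sigma_-(z)\Delta_\lambda(w^{-\lambda},H_r)=\frac{z^{r-1}}{w^{r-1}}\,\frac1{E_r(z)}\,\Delta_\lambda(w^{-\lambda},\overline\sigma_-(z)H_r).$$ In particular, for all $i,j\ge 0$, $\mathcal E_{ij}\Delta_\lambda(H_r)$ is the coefficient of $z^iw^{-j}$ in the right-hand side. -/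

import Mathlib

namespace Grass

noncomputable section

/-- The free abelian group `M = ⨁_{i ≥ 0} ℤ b_i`. -/
abbrev M : Type := ℕ →₀ ℤ

/-- The basis element `b_i`. -/
def b (i : ℕ) : M := Finsupp.single i 1

/-- The elementary endomorphism `ℰ_{ij} = b_i ⊗ β_j`, i.e. `b_k ↦ δ_{jk} b_i`. -/
def elem (i j : ℕ) : Module.End ℤ M :=
  (Finsupp.lsingle i).comp (Finsupp.lapply j)

theorem elem_b (i j k : ℕ) : elem i j (b k) = if j = k then b i else 0 := by
  simp only [elem, b, LinearMap.comp_apply, Finsupp.lapply_apply, Finsupp.lsingle_apply,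
    Finsupp.single_apply, eq_comm (a := k)]
  split_ifs <;> simp

/-! ### The representation of endomorphisms of `M` on the exterior algebra -/

/-- The algebra homomorphism `u ↦ u + ε δ(A) u` into the dual numbers over `⋀ M`. -/
def deltaHom (A : Module.End ℤ M) :
    ExteriorAlgebra ℤ M →ₐ[ℤ] DualNumber (ExteriorAlgebra ℤ M) :=
  ExteriorAlgebra.lift ℤ
    ⟨(TrivSqZeroExt.inlAlgHom ℤ _ _).toLinearMap.comp (ExteriorAlgebra.ι ℤ) +
      ((TrivSqZeroExt.inrHom (ExteriorAlgebra ℤ M) (ExteriorAlgebra ℤ M)).restrictScalars ℤ).comp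
        ((ExteriorAlgebra.ι ℤ).comp A), fun m => by
      ext
      · simp
      · simp [ExteriorAlgebra.ι_add_mul_swap]⟩

/-- `δ(A)`: the unique derivation of `⋀ M` which extends `A : M → M`. -/
def delta (A : Module.End ℤ M) : Module.End ℤ (ExteriorAlgebra ℤ M) :=
  ((TrivSqZeroExt.sndHom (ExteriorAlgebra ℤ M) (ExteriorAlgebra ℤ M)).restrictScalars ℤ).comp
    (deltaHom A).toLinearMap

theorem delta_ι (A : Module.End ℤ M) (u : M) :
    delta A (ExteriorAlgebra.ι ℤ u) = ExteriorAlgebra.ι ℤ (A u) := by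
  simp [delta, deltaHom]

theorem deltaHom_fst (A : Module.End ℤ M) (x : ExteriorAlgebra ℤ M) :
    (deltaHom A x).fst = x := by
  have : (TrivSqZeroExt.fstHom ℤ (ExteriorAlgebra ℤ M) (ExteriorAlgebra ℤ M)).comp (deltaHom A)
      = AlgHom.id ℤ _ := by
    apply ExteriorAlgebra.hom_ext
    ext m
    simp [deltaHom]
  exact DFunLike.congr_fun this x

/-- The Leibniz rule. -/
theorem delta_mul (A : Module.End ℤ M) (v w : ExteriorAlgebra ℤ M) :
    delta A (v * w) = delta A v * w + v * delta A w := by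
  simp [delta, deltaHom_fst, add_comm]

theorem delta_algebraMap (A : Module.End ℤ M) (n : ℤ) :
    delta A (algebraMap ℤ _ n) = 0 := by
  have h1 : delta A 1 = 0 := by
    have := delta_mul A 1 1
    simpa using this
  rw [Algebra.algebraMap_eq_smul_one, map_smul, h1, smul_zero]

theorem ι_mul_mem (u : M) {r : ℕ} {x : ExteriorAlgebra ℤ M} (hx : x ∈ ⋀[ℤ]^r M) :
    ExteriorAlgebra.ι ℤ u * x ∈ ⋀[ℤ]^(r + 1) M := by
  have : ⋀[ℤ]^(r + 1) M = LinearMap.range (ExteriorAlgebra.ι ℤ : M →ₗ[ℤ] _) * ⋀[ℤ]^r M :=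
    pow_succ' _ _
  rw [this]
  exact Submodule.mul_mem_mul (LinearMap.mem_range_self _ u) hx

theorem delta_mem (A : Module.End ℤ M) {r : ℕ} {x : ExteriorAlgebra ℤ M}
    (hx : x ∈ ⋀[ℤ]^r M) : delta A x ∈ ⋀[ℤ]^r M := by
  induction hx using Submodule.pow_induction_on_left' with
  | algebraMap n => rw [delta_algebraMap]; exact zero_mem _
  | add x y i hx hy h1 h2 => rw [map_add]; exact add_mem h1 h2
  | mem_mul m hm i x hx ih =>
    obtain ⟨u, rfl⟩ := hm
    rw [delta_mul, delta_ι]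
    exact add_mem (ι_mul_mem _ hx) (ι_mul_mem _ ih)

/-- The action of `A` on the `r`-th exterior power: the restriction of `δ(A)`. -/
def deltaPow (r : ℕ) (A : Module.End ℤ M) : Module.End ℤ (⋀[ℤ]^r M) :=
  (delta A).restrict fun _ hx => delta_mem A hx

/-- For fixed `i` and `v`, only finitely many `ℰ_{ij}` act on `v` in a non-zero way. -/
theorem delta_elem_finite (i : ℕ) (v : ExteriorAlgebra ℤ M) :
    {j : ℕ | delta (elem i j) v ≠ 0}.Finite := by
  induction v using ExteriorAlgebra.induction with
  | algebraMap n => simp only [delta_algebraMap, ne_eq, not_true_eq_false, Set.ofPred_false, Set.finite_empty]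
  | ι x =>
    refine x.support.finite_toSet.subset fun j hj => ?_
    rw [Finset.mem_coe, Finsupp.mem_support_iff]
    intro h0
    apply hj
    simp [delta_ι, elem, h0]
  | mul a c ha hc =>
    refine (ha.union hc).subset fun j hj => ?_
    by_contra h
    simp only [Set.mem_union, Set.mem_ofPred_eq, not_or, not_not] at h
    exact hj (by rw [delta_mul, h.1, h.2]; simp)
  | add a c ha hc =>
    refine (ha.union hc).subset fun j hj => ?_
    by_contra h
    simp only [Set.mem_union, Set.mem_ofPred_eq, not_or, not_not] at h
    exact hj (by rw [map_add, h.1, h.2, add_zero])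

/-! ### The ring `B_r` and Schur determinants -/

/-- `B_r = ℤ[e_1, …, e_r]`; the variable `X k` is `e_{k+1}`. -/
abbrev B (r : ℕ) : Type := MvPolynomial (Fin r) ℤ

/-- `E_r(z) = 1 - e_1 z + ⋯ + (-1)^r e_r z^r`. -/
def E (r : ℕ) : PowerSeries (B r) :=
  1 + ∑ k : Fin r, PowerSeries.C ((-1) ^ ((k : ℕ) + 1) * MvPolynomial.X k) * PowerSeries.X ^ ((k : ℕ) + 1)

/-- The power series `1 / E_r(z)`. -/
def invE (r : ℕ) : PowerSeries (B r) := PowerSeries.invOfUnit (E r) 1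

theorem E_mul_invE (r : ℕ) : E r * invE r = 1 := by
  apply PowerSeries.mul_invOfUnit
  rw [E, map_add, map_one, map_sum, Units.val_one, Finset.sum_eq_zero, add_zero]
  intro k _
  simp

/-- The sequence `H_r = (h_j)_{j ∈ ℤ}` with `∑ h_j z^j = 1 / E_r(z)`; `h_j = 0` for `j < 0`. -/
def h (r : ℕ) (j : ℤ) : B r := if 0 ≤ j then PowerSeries.coeff j.toNat (invE r) else 0

/-- The Schur determinant `Δ_λ(H_r) = det (h_{λ_j - j + i})`. -/
def schur (r : ℕ) (lam : Fin r → ℕ) : B r :=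
  (Matrix.of fun i j : Fin r => h r ((lam j : ℤ) - (j : ℕ) + (i : ℕ))).det

/-- `[b]^r_λ = b_{r-1+λ_1} ∧ ⋯ ∧ b_{λ_r}`. -/
def bWedge (r : ℕ) (lam : Fin r → ℕ) : ⋀[ℤ]^r M :=
  exteriorPower.ιMulti ℤ r fun j : Fin r => b (r - 1 - (j : ℕ) + lam j)

/-- Given a sequence of column vectors `c_0, c_1, …`, the `ℤ`-linear map on `⋀^r M` with
`b_{n_1} ∧ ⋯ ∧ b_{n_r} ↦ det (c_{n_1}, …, c_{n_r})`. -/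
def colDet (r : ℕ) {A : Type} [CommRing A] (c : ℕ → Fin r → A) : ⋀[ℤ]^r M →ₗ[ℤ] A :=
  exteriorPower.alternatingMapLinearEquiv
    (AlternatingMap.compLinearMap
      { (Matrix.detRowAlternating (n := Fin r) (R := A)).toMultilinearMap.restrictScalars ℤ with
        map_eq_zero_of_eq' := fun v _ _ hv hij =>
          (Matrix.detRowAlternating (n := Fin r) (R := A)).map_eq_zero_of_eq v hv hij }
      (Finsupp.linearCombination ℤ c))

theorem colDet_b (r : ℕ) {A : Type} [CommRing A] (c : ℕ → Fin r → A) (n : Fin r → ℕ) :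
    colDet r c (exteriorPower.ιMulti ℤ r fun j => b (n j)) =
      (Matrix.of fun i j => c (n j) i).det := by
  rw [← Matrix.det_transpose]
  simp only [colDet, exteriorPower.alternatingMapLinearEquiv_apply_ιMulti]
  change Matrix.det _ = Matrix.det _
  congr 1
  ext i j
  simp [b]

theorem colDet_ext (r : ℕ) {A : Type} [AddCommGroup A] {f g : ⋀[ℤ]^r M →ₗ[ℤ] A}
    (hfg : ∀ n : Fin r → ℕ, f (exteriorPower.ιMulti ℤ r fun j => b (n j)) =
      g (exteriorPower.ιMulti ℤ r fun j => b (n j))) : f = g := by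
  apply exteriorPower.linearMap_ext
  refine Module.Basis.ext_alternating (Finsupp.basisSingleOne (R := ℤ) (ι := ℕ)) fun v _ => ?_
  simpa [b] using hfg v

/-- The `ℤ`-linear map `⋀^r M → B_r` with `[b]^r_λ ↦ Δ_λ(H_r)`. -/
def schurMap (r : ℕ) : ⋀[ℤ]^r M →ₗ[ℤ] B r :=
  colDet r fun n i => h r ((n : ℤ) - (r - 1) + (i : ℕ))

theorem schurMap_bWedge (r : ℕ) (lam : Fin r → ℕ) : schurMap r (bWedge r lam) = schur r lam := by
  rw [schurMap, bWedge, colDet_b, schur]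
  congr 1
  ext1 i j
  simp only [Matrix.of_apply]
  congr 1
  have := j.isLt
  omega

/-! ### The Schur determinants form a `ℤ`-basis of `B_r` -/

/-- The embedding of `B_r` into polynomials in `x_1, …, x_r`, `e_k ↦` the `k`-th elementary
symmetric polynomial. -/
def toSymm (r : ℕ) : B r →+* MvPolynomial (Fin r) ℤ :=
  (MvPolynomial.aeval fun i : Fin r => MvPolynomial.esymm (Fin r) ℤ (i + 1) :
    B r →ₐ[ℤ] MvPolynomial (Fin r) ℤ).toRingHom

theorem toSymm_injective (r : ℕ) : Function.Injective (toSymm r) := by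
  intro p q hpq
  apply MvPolynomial.esymmAlgHom_injective (σ := Fin r) (n := r) ℤ (by simp)
  apply Subtype.ext
  rw [MvPolynomial.esymmAlgHom_apply, MvPolynomial.esymmAlgHom_apply]
  exact hpq

theorem toSymm_isSymmetric (r : ℕ) (p : B r) : (toSymm r p).IsSymmetric := by
  have := (MvPolynomial.esymmAlgHom (Fin r) ℤ r p).2
  rw [MvPolynomial.mem_symmetricSubalgebra, MvPolynomial.esymmAlgHom_apply] at this
  exact this

theorem map_E (r : ℕ) : PowerSeries.map (toSymm r) (E r) =
    ∏ k : Fin r, (1 + -(PowerSeries.C (MvPolynomial.X k) * PowerSeries.X)) := by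
  rw [Finset.prod_one_add, Finset.sum_powerset, Finset.card_univ, Fintype.card_fin,
    Finset.sum_range_succ', E, map_add, map_one, map_sum, add_comm, Finset.sum_range]
  congr 1
  · refine Finset.sum_congr rfl fun k _ => ?_
    have : toSymm r (MvPolynomial.X k) = MvPolynomial.esymm (Fin r) ℤ (k + 1) := by
      simp [toSymm]
    rw [map_mul, map_pow, PowerSeries.map_X, PowerSeries.map_C, map_mul, map_pow, map_neg, map_one,
      this, MvPolynomial.esymm, Finset.mul_sum, map_sum, Finset.sum_mul]
    refine Finset.sum_congr rfl fun t ht => ?_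
    rw [Finset.prod_neg, (Finset.mem_powersetCard.1 ht).2, Finset.prod_mul_distrib,
      Finset.prod_const, (Finset.mem_powersetCard.1 ht).2, map_mul, map_pow, map_neg, map_one,
      map_prod, mul_assoc]
  · simp

/-- The coefficient matrix `A` with `A (c_{n}) = (x_l ^ n)_l`. -/
def auxMat (r : ℕ) : Matrix (Fin r) (Fin r) (MvPolynomial (Fin r) ℤ) :=
  Matrix.of fun l i => PowerSeries.coeff (r - 1 - (i : ℕ))
    (∏ k ∈ Finset.univ.erase l, (1 + -(PowerSeries.C (MvPolynomial.X k) * PowerSeries.X)))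

theorem coeff_prod_eq_zero {A : Type} [CommRing A] {ι : Type} (s : Finset ι) (x : ι → A) :
    ∀ m : ℕ, s.card < m → PowerSeries.coeff m
      (∏ k ∈ s, (1 + -(PowerSeries.C (x k) * PowerSeries.X))) = 0 := by
  classical
  induction s using Finset.induction_on with
  | empty =>
    intro m hm
    rw [Finset.prod_empty, PowerSeries.coeff_one, if_neg]
    rw [Finset.card_empty] at hm
    omega
  | insert a s ha ih =>
    intro m hm
    rw [Finset.card_insert_of_notMem ha] at hm
    obtain ⟨m, rfl⟩ : ∃ m', m = m' + 1 := ⟨m - 1, by omega⟩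
    rw [Finset.prod_insert ha, add_mul, one_mul, neg_mul, map_add, map_neg, mul_assoc,
      PowerSeries.coeff_C_mul, PowerSeries.coeff_succ_X_mul, ih _ (by omega), ih _ (by omega)]
    simp

theorem auxMat_mul (r : ℕ) (l : Fin r) (n : ℕ) :
    ∑ i : Fin r, auxMat r l i * toSymm r (h r ((n : ℤ) - (r - 1) + (i : ℕ))) =
      MvPolynomial.X l ^ n := by
  set F := ∏ k ∈ Finset.univ.erase l,
    (1 + -(PowerSeries.C (MvPolynomial.X k : MvPolynomial (Fin r) ℤ) * PowerSeries.X)) with hF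
  set G := PowerSeries.map (toSymm r) (invE r) with hG
  have h1 : (1 + -(PowerSeries.C (MvPolynomial.X l) * PowerSeries.X)) * (F * G) = 1 := by
    rw [← mul_assoc, hF, Finset.mul_prod_erase _
      (fun k => (1 + -(PowerSeries.C (MvPolynomial.X k : MvPolynomial (Fin r) ℤ) *
        PowerSeries.X))) (Finset.mem_univ l), ← map_E, hG, ← map_mul,
      E_mul_invE, map_one]
  have h2 : ∀ m, PowerSeries.coeff m (F * G) = MvPolynomial.X l ^ m := by
    intro m
    induction m with
    | zero => simpa [add_mul] using congrArg (PowerSeries.coeff 0) h1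
    | succ m ih =>
      have := congrArg (PowerSeries.coeff (m + 1)) h1
      rw [add_mul, one_mul, neg_mul, map_add, map_neg, mul_assoc, PowerSeries.coeff_C_mul,
        PowerSeries.coeff_succ_X_mul, ih, PowerSeries.coeff_one, if_neg (by omega)] at this
      rw [pow_succ', ← sub_eq_zero, sub_eq_add_neg, this]
  have h3 : ∀ m, r ≤ m → PowerSeries.coeff m F = 0 := by
    intro m hm
    apply coeff_prod_eq_zero
    rw [Finset.card_erase_of_mem (Finset.mem_univ l), Finset.card_univ, Fintype.card_fin]
    have := l.isLt
    omega
  rw [← h2 n, PowerSeries.coeff_mul, Finset.Nat.sum_antidiagonal_eq_sum_range_succ_mk]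
  let g : ℕ → MvPolynomial (Fin r) ℤ := fun a =>
    PowerSeries.coeff a F * toSymm r (h r ((n : ℤ) - a))
  have h4 : ∑ a ∈ Finset.range n.succ, PowerSeries.coeff a F * PowerSeries.coeff (n - a) G =
      ∑ a ∈ Finset.range (n.succ + r), g a := by
    have : ∀ a ∈ Finset.range n.succ,
        PowerSeries.coeff a F * PowerSeries.coeff (n - a) G = g a := by
      intro a ha
      rw [Finset.mem_range] at ha
      simp only [g, h]
      rw [if_pos (by omega), hG, PowerSeries.coeff_map]
      congr 4
      omega
    rw [Finset.sum_congr rfl this]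
    apply Finset.sum_subset
    · intro a ha
      rw [Finset.mem_range] at *
      omega
    · intro a _ ha
      rw [Finset.mem_range] at ha
      simp only [h]
      rw [if_neg (by omega), map_zero, mul_zero]
  have h5 : ∑ i : Fin r, auxMat r l i * toSymm r (h r ((n : ℤ) - (r - 1) + (i : ℕ))) =
      ∑ a ∈ Finset.range (n.succ + r), g a := by
    rw [← Finset.sum_subset (s₁ := Finset.range r), Finset.sum_range, ← Equiv.sum_comp Fin.revPerm]
    · refine Finset.sum_congr rfl fun i _ => ?_
      simp only [g, auxMat, Matrix.of_apply, Fin.revPerm_apply, Fin.val_rev]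
      have := i.isLt
      rw [show r - 1 - (r - (↑i + 1)) = (i : ℕ) by omega,
        show (n : ℤ) - (r - 1) + ((r - (↑i + 1) : ℕ) : ℤ) = n - (i : ℕ) by omega]
    · intro a ha
      rw [Finset.mem_range] at *
      omega
    · intro a _ ha
      rw [Finset.mem_range] at ha
      simp only [g]
      rw [h3 a (by omega), zero_mul]
  rw [h4, h5]

theorem det_aux (r : ℕ) (v : ⋀[ℤ]^r M) :
    colDet r (fun n (l : Fin r) => (MvPolynomial.X l : MvPolynomial (Fin r) ℤ) ^ n) v =
      (auxMat r).det * toSymm r (schurMap r v) := by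
  have : colDet r (fun n (l : Fin r) => (MvPolynomial.X l : MvPolynomial (Fin r) ℤ) ^ n) =
      (LinearMap.mulLeft ℤ (auxMat r).det).comp
        ((toSymm r).toIntAlgHom.toLinearMap.comp (schurMap r)) := by
    apply colDet_ext
    intro n
    simp only [LinearMap.comp_apply, schurMap, colDet_b, LinearMap.mulLeft_apply]
    change _ = _ * toSymm r _
    rw [RingHom.map_det, ← Matrix.det_mul]
    congr 1
    ext1 l j
    rw [Matrix.mul_apply]
    exact (auxMat_mul r l (n j)).symm
  exact DFunLike.congr_fun this v

/-- The `ℤ`-linear map with `x^p ↦ b_{p_1} ∧ ⋯ ∧ b_{p_r}`. -/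
def wedgeOf (r : ℕ) : MvPolynomial (Fin r) ℤ →ₗ[ℤ] ⋀[ℤ]^r M :=
  (MvPolynomial.basisMonomials (Fin r) ℤ).constr ℤ fun p =>
    exteriorPower.ιMulti ℤ r fun j => b (p j)

/-- Antisymmetrization. -/
def antisymm (r : ℕ) : MvPolynomial (Fin r) ℤ →ₗ[ℤ] MvPolynomial (Fin r) ℤ :=
  ∑ σ : Equiv.Perm (Fin r), ((Equiv.Perm.sign σ : ℤ)) • (MvPolynomial.rename σ).toLinearMap

theorem antisymm_apply (r : ℕ) (f : MvPolynomial (Fin r) ℤ) :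
    antisymm r f =
      ∑ σ : Equiv.Perm (Fin r), ((Equiv.Perm.sign σ : ℤ)) • MvPolynomial.rename σ f := by
  simp [antisymm]

theorem antisymm_mul (r : ℕ) (s f : MvPolynomial (Fin r) ℤ) (hs : s.IsSymmetric) :
    antisymm r (s * f) = s * antisymm r f := by
  simp only [antisymm_apply, map_mul, hs _, Finset.mul_sum, mul_smul_comm]

theorem antisymm_eq (r : ℕ) (f : MvPolynomial (Fin r) ℤ) : antisymm r f =
    colDet r (fun n (l : Fin r) => (MvPolynomial.X l : MvPolynomial (Fin r) ℤ) ^ n)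
      (wedgeOf r f) := by
  have : antisymm r =
    (colDet r (fun n (l : Fin r) => (MvPolynomial.X l : MvPolynomial (Fin r) ℤ) ^ n)).comp
      (wedgeOf r) := by
    apply (MvPolynomial.basisMonomials (Fin r) ℤ).ext
    intro p
    rw [LinearMap.comp_apply, wedgeOf, Module.Basis.constr_basis, colDet_b, antisymm_apply,
      Matrix.det_apply]
    refine Finset.sum_congr rfl fun σ _ => ?_
    rw [Units.smul_def]
    congr 1
    simp only [MvPolynomial.coe_basisMonomials, Matrix.of_apply]
    rw [MvPolynomial.monomial_eq, map_mul, MvPolynomial.rename_C,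
      map_one, one_mul, Finsupp.prod_fintype _ _ (by simp), map_prod]
    simp
  exact DFunLike.congr_fun this f

theorem colDet_X_injective (r : ℕ) : Function.Injective
    (colDet r (fun n (l : Fin r) => (MvPolynomial.X l : MvPolynomial (Fin r) ℤ) ^ n)) := by
  have key : ∀ v, wedgeOf r (colDet r
      (fun n (l : Fin r) => (MvPolynomial.X l : MvPolynomial (Fin r) ℤ) ^ n) v) =
        (r.factorial : ℤ) • v := by
    intro v
    have : (wedgeOf r).comp (colDet r
      (fun n (l : Fin r) => (MvPolynomial.X l : MvPolynomial (Fin r) ℤ) ^ n)) =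
        (r.factorial : ℤ) • LinearMap.id := by
      apply colDet_ext
      intro n
      rw [LinearMap.comp_apply, colDet_b, Matrix.det_apply, map_sum]
      have : ∀ σ ∈ (Finset.univ : Finset (Equiv.Perm (Fin r))), wedgeOf r (Equiv.Perm.sign σ •
          ∏ i, Matrix.of (fun i j : Fin r =>
            (MvPolynomial.X i : MvPolynomial (Fin r) ℤ) ^ n j) (σ i) i) =
          exteriorPower.ιMulti ℤ r fun j => b (n j) := by
        intro σ _
        have h1 : ∏ i, Matrix.of (fun i j : Fin r =>
            (MvPolynomial.X i : MvPolynomial (Fin r) ℤ) ^ n j) (σ i) i =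
            MvPolynomial.basisMonomials (Fin r) ℤ (Finsupp.equivFunOnFinite.symm (n ∘ σ.symm)) := by
          simp only [MvPolynomial.coe_basisMonomials, Matrix.of_apply]
          rw [MvPolynomial.monomial_eq, map_one, one_mul,
            Finsupp.prod_fintype _ _ (by simp)]
          simpa using Equiv.prod_comp σ fun x =>
            (MvPolynomial.X x : MvPolynomial (Fin r) ℤ) ^ n (σ.symm x)
        rw [h1, Units.smul_def, map_zsmul, wedgeOf, Module.Basis.constr_basis]
        have h2 := (exteriorPower.ιMulti ℤ r (M := M)).map_perm (fun j => b (n j)) σ.symm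
        have h3 : (fun j => b ((Finsupp.equivFunOnFinite.symm (n ∘ σ.symm)) j)) =
          (fun j => b (n j)) ∘ σ.symm := by ext1 j; simp
        rw [h3, h2, Equiv.Perm.sign_symm, Units.smul_def, smul_smul]
        rcases Int.units_eq_one_or (Equiv.Perm.sign σ) with h | h <;> simp [h]
      rw [Finset.sum_congr rfl this]
      simp [Fintype.card_perm]
    exact DFunLike.congr_fun this v
  intro v w hvw
  have := (key v).symm.trans ((congrArg (wedgeOf r) hvw).trans (key w))
  exact smul_right_injective _ (by exact_mod_cast r.factorial_ne_zero) this

theorem h_zero (r : ℕ) : h r 0 = 1 := by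
  simp [h, invE, PowerSeries.constantCoeff_invOfUnit]

theorem h_neg (r : ℕ) {j : ℤ} (hj : j < 0) : h r j = 0 := if_neg (not_le.2 hj)

theorem schur_zero (r : ℕ) : schur r 0 = 1 := by
  rw [schur, Matrix.det_of_isLowerTriangular]
  · simp [h_zero]
  · intro i j hij
    have : i < j := hij
    exact h_neg r (by simp; omega)

theorem schurMap_bijective (r : ℕ) : Function.Bijective (schurMap r) := by
  have h0 : schurMap r (bWedge r 0) = 1 := by rw [schurMap_bWedge, schur_zero]
  have hinj : Function.Injective (schurMap r) := by
    intro v w hvw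
    apply colDet_X_injective
    rw [det_aux, det_aux, hvw]
  refine ⟨hinj, fun P => ?_⟩
  have hD : (auxMat r).det ≠ 0 := by
    intro hD
    have h1 : bWedge r 0 = 0 := by
      apply colDet_X_injective
      rw [det_aux, hD, zero_mul, map_zero]
    rw [h1, map_zero] at h0
    exact zero_ne_one h0
  let p : Fin r →₀ ℕ := Finsupp.equivFunOnFinite.symm fun j : Fin r => r - 1 - (j : ℕ)
  have h1 : wedgeOf r (MvPolynomial.basisMonomials (Fin r) ℤ p) = bWedge r 0 := by
    rw [wedgeOf, Module.Basis.constr_basis]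
    rfl
  refine ⟨wedgeOf r (toSymm r P * MvPolynomial.basisMonomials (Fin r) ℤ p), ?_⟩
  apply toSymm_injective
  apply mul_left_cancel₀ hD
  rw [← det_aux, ← antisymm_eq, antisymm_mul _ _ _ (toSymm_isSymmetric r P), antisymm_eq, h1,
    det_aux, h0, map_one, mul_one, mul_comm]

/-- The `ℤ`-module isomorphism `φ_r : B_r → ⋀^r M` with `Δ_λ(H_r) ↦ [b]^r_λ`. -/
def phi (r : ℕ) : B r ≃ₗ[ℤ] ⋀[ℤ]^r M :=
  (LinearEquiv.ofBijective (schurMap r) (schurMap_bijective r)).symm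

theorem phi_schur (r : ℕ) (lam : Fin r → ℕ) : phi r (schur r lam) = bWedge r lam := by
  rw [phi, LinearEquiv.symm_apply_eq, LinearEquiv.ofBijective_apply, schurMap_bWedge]

/-! ### The Lie algebra action on `B_r` and its generating function -/

/-- The action of `A` on `B_r`, transported from `⋀^r M` along `φ_r`:
`φ_r (A · P) = δ(A) (φ_r P)`. -/
def glAct (r : ℕ) (A : Module.End ℤ M) : Module.End ℤ (B r) :=
  (phi r).symm.toLinearMap.comp ((deltaPow r A).comp (phi r).toLinearMap)

theorem phi_glAct (r : ℕ) (A : Module.End ℤ M) (P : B r) :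
    phi r (glAct r A P) = deltaPow r A (phi r P) := by
  simp [glAct]

theorem glAct_finite (r i : ℕ) (P : B r) : {j : ℕ | glAct r (elem i j) P ≠ 0}.Finite := by
  refine (delta_elem_finite i (phi r P : ExteriorAlgebra ℤ M)).subset fun j hj h0 => hj ?_
  rw [← (phi r).map_eq_zero_iff, phi_glAct]
  exact Subtype.ext h0

/-- The ring `B_r[w, w⁻¹]((z))` of Laurent series in `z` over the Laurent polynomials in `w`. It
contains `B_r[w⁻¹][[z]]` and `B_r[z, z⁻¹, w, w⁻¹]`. -/
abbrev GenRing (r : ℕ) : Type := LaurentSeries (LaurentPolynomial (B r))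

/-- The monomial `z ^ n`. -/
def zPow (r : ℕ) (n : ℤ) : GenRing r := HahnSeries.single n 1

/-- The monomial `w ^ n`. -/
def wPow (r : ℕ) (n : ℤ) : GenRing r := HahnSeries.C (LaurentPolynomial.T n)

/-- The inclusion of `B_r` as constants. -/
def const (r : ℕ) : B r →+* GenRing r := HahnSeries.C.comp LaurentPolynomial.C

/-- `1 / E_r(z)` as an element of `B_r[w, w⁻¹]((z))`. -/
def invEz (r : ℕ) : GenRing r :=
  HahnSeries.ofPowerSeries ℤ _ (PowerSeries.map LaurentPolynomial.C (invE r))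

/-- The coefficient of `z ^ i * w ^ n`. -/
def coeffZW (r : ℕ) (i n : ℤ) (F : GenRing r) : B r := (F.coeff i).coeff n

/-- `ℰ(z, w) P = ∑_{i, j ≥ 0} (ℰ_{ij} P) z^i w^{-j}`; for each `i` the sum over `j` is finite. -/
def genE (r : ℕ) (P : B r) : GenRing r :=
  HahnSeries.ofPowerSeries ℤ _ (PowerSeries.mk fun i =>
    ∑ j ∈ (glAct_finite r i P).toFinset,
      LaurentPolynomial.C (glAct r (elem i j) P) * LaurentPolynomial.T (-(j : ℤ)))

/-! ### The Schubert derivation `σ̄_-(z)` -/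

/-- The shift `σ_{-1}` on `M`: `b_j ↦ b_{j-1}` for `j ≥ 1` and `b_0 ↦ 0`. -/
def shiftDown : M →ₗ[ℤ] M :=
  Finsupp.linearCombination ℤ fun j => if j = 0 then 0 else b (j - 1)

/-- The Hasse-Schmidt derivation `σ̄_-(z)` on `⋀ M`, i.e. the multiplicative map
`⋀ M → ⋀ M[z⁻¹]` with `b_j ↦ b_j - b_{j-1} z⁻¹` (where `b_{-1} = 0`). The polynomial variable
is `z⁻¹`. It is the inverse of the Hasse-Schmidt derivation `σ_-(z)` with
`σ_-(z) b_j = ∑_{i ≤ j} b_{j-i} z^{-i}`. -/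
def sigmaBarHom : ExteriorAlgebra ℤ M →ₐ[ℤ] Polynomial (ExteriorAlgebra ℤ M) :=
  ExteriorAlgebra.lift ℤ
    ⟨((Polynomial.monomial 0).restrictScalars ℤ).comp (ExteriorAlgebra.ι ℤ) -
      ((Polynomial.monomial 1).restrictScalars ℤ).comp ((ExteriorAlgebra.ι ℤ).comp shiftDown),
      fun m => by
        have hsw := ExteriorAlgebra.ι_add_mul_swap (R := ℤ) m (shiftDown m)
        simp only [LinearMap.sub_apply, LinearMap.comp_apply, LinearMap.restrictScalars_apply,
          sub_mul, mul_sub, Polynomial.monomial_mul_monomial, ExteriorAlgebra.ι_sq_zero,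
          Polynomial.monomial_zero_right, zero_add, add_zero, zero_sub, sub_zero]
        rw [← neg_add', ← map_add, add_comm, hsw, map_zero, neg_zero]⟩

theorem sigmaBarHom_ι (u : M) : sigmaBarHom (ExteriorAlgebra.ι ℤ u) =
    Polynomial.C (ExteriorAlgebra.ι ℤ u) -
      Polynomial.monomial 1 (ExteriorAlgebra.ι ℤ (shiftDown u)) := by
  simp [sigmaBarHom]

/-- `σ̄_-(z) (σ_-(z) b_j) = b_j`. -/
theorem sigmaBarHom_inverse (j : ℕ) :
    ∑ i ∈ Finset.range (j + 1),
      sigmaBarHom (ExteriorAlgebra.ι ℤ (b (j - i))) * Polynomial.X ^ i =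
        Polynomial.C (ExteriorAlgebra.ι ℤ (b j)) := by
  induction j with
  | zero => simp [sigmaBarHom_ι, shiftDown, b]
  | succ j ih =>
    rw [Finset.sum_range_succ']
    simp only [Nat.add_sub_add_right, pow_succ, ← mul_assoc]
    rw [← Finset.sum_mul, ih, sigmaBarHom_ι]
    simp [shiftDown, b, Polynomial.C_mul_X_eq_monomial]

theorem sigmaBarHom_mem {r : ℕ} {x : ExteriorAlgebra ℤ M} (hx : x ∈ ⋀[ℤ]^r M) :
    ∀ k, (sigmaBarHom x).coeff k ∈ ⋀[ℤ]^r M ∧ (r < k → (sigmaBarHom x).coeff k = 0) := by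
  induction hx using Submodule.pow_induction_on_left' with
  | algebraMap n =>
    intro k
    rw [AlgHom.commutes, Polynomial.algebraMap_apply, Polynomial.coeff_C]
    split_ifs with hk
    · exact ⟨(Submodule.algebraMap_mem n : _), fun h => by omega⟩
    · exact ⟨zero_mem _, fun _ => rfl⟩
  | add x y i hx hy h1 h2 =>
    intro k
    rw [map_add, Polynomial.coeff_add]
    exact ⟨add_mem (h1 k).1 (h2 k).1, fun hk => by rw [(h1 k).2 hk, (h2 k).2 hk, add_zero]⟩
  | mem_mul m hm i x hx ih =>
    obtain ⟨u, rfl⟩ := hm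
    intro k
    rw [map_mul, sigmaBarHom_ι, sub_mul, Polynomial.coeff_sub, Polynomial.coeff_C_mul,
      ← Polynomial.C_mul_X_eq_monomial, mul_assoc, Polynomial.coeff_C_mul]
    rcases k with _ | k
    · rw [Polynomial.coeff_X_mul_zero, mul_zero, sub_zero]
      exact ⟨ι_mul_mem u (ih 0).1, fun h => by omega⟩
    · rw [Polynomial.coeff_X_mul]
      refine ⟨sub_mem (ι_mul_mem u (ih _).1) (ι_mul_mem _ (ih _).1), fun hk => ?_⟩
      rw [(ih _).2 (by omega), (ih _).2 (by omega), mul_zero, mul_zero, sub_zero]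

/-- The coefficient of `z^{-k}` in `σ̄_-(z)`, restricted to `⋀^r M` (it vanishes for `k > r`). -/
def sigmaBarCoeff (r k : ℕ) : Module.End ℤ (⋀[ℤ]^r M) :=
  (((Polynomial.lcoeff (ExteriorAlgebra ℤ M) k).restrictScalars ℤ).comp
    sigmaBarHom.toLinearMap).restrict fun _ hx => (sigmaBarHom_mem hx k).1

/-- The map `σ̄_-(z) : B_r → B_r[z⁻¹]`, transported from `⋀^r M` along `φ_r`. -/
def sigmaBar (r : ℕ) : B r →+ GenRing r where
  toFun P := ∑ k ∈ Finset.range (r + 1),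
    const r ((phi r).symm (sigmaBarCoeff r k (phi r P))) * zPow r (-(k : ℤ))
  map_zero' := by simp
  map_add' P Q := by simp [add_mul, Finset.sum_add_distrib]

/-- The extension of `σ̄_-(z)` to `B_r[w, w⁻¹]`, acting on each coefficient of `w ^ n`. -/
def sigmaBarW (r : ℕ) (F : LaurentPolynomial (B r)) : GenRing r :=
  F.coeff.sum fun n P => wPow r n * sigmaBar r P

/-! ### The determinants -/

/-- `σ̄_-(z) h_j = h_j - h_{j-1} / z`. -/
def hBar (r : ℕ) (j : ℤ) : GenRing r := const r (h r j) - const r (h r (j - 1)) * zPow r (-1)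

/-- The determinant `Δ_λ(w^{-λ}, H_r)`, with first row `w^{j-1-λ_j}` and the entries
`h_{λ_j-j+i}` in the rows `i ≥ 2`. -/
def detW (r : ℕ) (lam : Fin r → ℕ) : LaurentPolynomial (B r) :=
  (Matrix.of fun i j : Fin r =>
    if (i : ℕ) = 0 then LaurentPolynomial.T ((j : ℤ) - lam j)
    else LaurentPolynomial.C (h r ((lam j : ℤ) - (j : ℕ) + (i : ℕ)))).det

/-- The determinant `Δ_λ(w^{-λ}, σ̄_-(z) H_r)`, with first row `w^{j-1-λ_j}` and the entries
`h_{λ_j-j+i} - h_{λ_j-j+i-1} / z` in the rows `i ≥ 2`. -/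
def detWBar (r : ℕ) (lam : Fin r → ℕ) : GenRing r :=
  (Matrix.of fun i j : Fin r =>
    if (i : ℕ) = 0 then wPow r ((j : ℤ) - lam j)
    else hBar r ((lam j : ℤ) - (j : ℕ) + (i : ℕ))).det

end

end Grass

open Grass

namespace Grass

/-! Write r = n + 1. Under `schurMap` the vector b_m becomes the column (h_{m-n+i}), 0 ≤ i ≤ n, so
Δ_λ is the determinant of a matrix A whose k-th column (counted from 0) is that of b_{n-k+λ_k}. By
the Leibniz rule ℰ_{mj} puts the column of b_m in place of each column k with n-k+λ_k = j, and
Cramer's rule gives Σ_i adj(A)_{ki} h_{m-n+i}. Since Σ_m h_{m-n+i} z^m = z^{n-i}/E_r(z), summing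
over m and j leaves z^n w^{-n}/E_r(z) times Σ_k w^{k-λ_k} Σ_i adj(A)_{ki} z^{-i}. The inner sum is
det A with k-th column (z^{-i}). Subtracting z^{-1} times the preceding row from each later row
turns that column into the first unit vector and h_j into h_j - h_{j-1}/z, so the sum over k is the
Laplace expansion of `detWBar` along its first row (`sum_adjugate_mul_pow`,
`genE_schur_eq_detWBar`).

For the form with σ̄_-(z), the same Laplace expansion reduces the claim to the first-row cofactors.
The map is multiplicative on wedges, not on B_r, so a cofactor of size n is first rewritten as the
image of an r-fold wedge containing b_0; there σ̄_-(z) acts column by column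
(`sigmaBar_schurMap_eq_det`, `sigmaBar_adjugate`). -/

/-! ### Cramer's rule and first-row cofactors -/

open Matrix in
/-- If `A` becomes `R` by subtracting `t` times the preceding row from each row but the first,
then Cramer's rule for `A` and the geometric column `(t ^ i)` gives the first column of the
adjugate of `R`. -/
theorem sum_adjugate_mul_pow {S : Type*} [CommRing S] {n : ℕ}
    {A R : Matrix (Fin (n + 1)) (Fin (n + 1)) S} (t : S) (hzero : ∀ l, A 0 l = R 0 l)
    (hsucc : ∀ (i : Fin n) l, A i.succ l = R i.succ l + t * A i.castSucc l) (k : Fin (n + 1)) :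
    ∑ i, A.adjugate k i * t ^ (i : ℕ) = R.adjugate k 0 := by
  have h1 : ∑ i, A.adjugate k i * t ^ (i : ℕ) = (A.updateCol k fun i => t ^ (i : ℕ)).det := by
    rw [← cramer_apply, cramer_eq_adjugate_mulVec]
    rfl
  have h2 : R.adjugate k 0 = (R.updateCol k (Pi.single 0 1)).det := by
    rw [← cramer_apply, cramer_eq_adjugate_mulVec]
    simp
  rw [h1, h2]
  -- The replaced columns obey the same row recursion: t ^ (i + 1) = 0 + t * t ^ i, starting from 1.
  refine det_eq_of_forall_row_eq_smul_add_pred (fun _ => t) (fun l => ?_) fun i l => ?_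
  · by_cases hl : l = k
    · subst hl; simp
    · simp [hl, hzero]
  · by_cases hl : l = k
    · subst hl; simp [pow_succ']
    · simp [hl, hsucc]

theorem det_eq_sum_adjugate {S : Type*} [CommRing S] {n : ℕ}
    (A : Matrix (Fin (n + 1)) (Fin (n + 1)) S) : A.det = ∑ k, A 0 k * A.adjugate k 0 := by
  rw [← Matrix.mul_apply, Matrix.mul_adjugate]
  simp

/-- First-row cofactors never see the first row, so powers of w and entries h_j may be exchanged
there freely. -/
theorem adjugate_zero_congr {S : Type*} [CommRing S] {n : ℕ}
    {A R : Matrix (Fin (n + 1)) (Fin (n + 1)) S} (hAR : ∀ (i : Fin n) l, A i.succ l = R i.succ l)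
    (k : Fin (n + 1)) : A.adjugate k 0 = R.adjugate k 0 := by
  simp only [Matrix.adjugate_fin_succ_eq_det_submatrix]
  congr 2
  ext i l
  simp [hAR]

/-- A matrix whose `k`-th column is the last unit vector has, up to sign, the determinant of the
minor obtained by deleting the first row and the `k`-th column of its downward shift. -/
theorem adjugate_zero_eq_det {S : Type*} [CommRing S] {n : ℕ}
    {A R : Matrix (Fin (n + 1)) (Fin (n + 1)) S} (k : Fin (n + 1))
    (hcol : ∀ i, A i k = if i = Fin.last n then 1 else 0)
    (hshift : ∀ (i : Fin n) l, l ≠ k → A i.castSucc l = R i.succ l) :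
    R.adjugate k 0 = (-1) ^ n * A.det := by
  rw [Matrix.det_succ_column A k, Finset.sum_eq_single (Fin.last n),
    Matrix.adjugate_fin_succ_eq_det_submatrix, hcol, if_pos rfl]
  · have : A.submatrix (Fin.last n).succAbove k.succAbove =
        R.submatrix (Fin.succAbove 0) k.succAbove := by
      ext i l
      simp [hshift i _ (Fin.succAbove_ne k l)]
    rw [this]
    -- The cofactor signs at rows n and 0 of column k are (-1) ^ (n + k) and (-1) ^ k.
    have h2 : ((-1 : S) ^ n) * (-1) ^ n = 1 := by rw [← mul_pow]; simp
    simp only [Fin.val_last, Fin.val_zero, pow_add, mul_one, pow_zero, one_mul, ← mul_assoc, h2]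
  · intro i _ hi
    simp [hcol, hi]
  · simp

/-! ### The action on decomposable vectors -/

/-- Extends `colDet_b` beyond basis vectors: an elementary endomorphism or a shift may turn a factor
into 0 or into `-shiftDown u`. -/
theorem colDet_ιMulti (r : ℕ) {A : Type} [CommRing A] (c : ℕ → Fin r → A) (u : Fin r → M) :
    colDet r c (exteriorPower.ιMulti ℤ r u) =
      (Matrix.of fun i j => Finsupp.linearCombination ℤ c (u j) i).det := by
  rw [← Matrix.det_transpose]
  simp only [colDet, exteriorPower.alternatingMapLinearEquiv_apply_ιMulti]
  rfl

theorem delta_ιMulti (A : Module.End ℤ M) {r : ℕ} (u : Fin r → M) :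
    delta A (ExteriorAlgebra.ιMulti ℤ r u) =
      ∑ k, ExteriorAlgebra.ιMulti ℤ r (Function.update u k (A (u k))) := by
  induction r with
  | zero =>
    have := delta_algebraMap A 1
    simpa using this
  | succ r ih =>
    rw [ExteriorAlgebra.ιMulti_succ_apply, delta_mul, delta_ι, ih, Fin.sum_univ_succ,
      Finset.mul_sum]
    congr 1
    · rw [ExteriorAlgebra.ιMulti_succ_apply]
      simp [Matrix.vecTail, Function.comp_def]
    · refine Finset.sum_congr rfl fun k _ => ?_
      rw [ExteriorAlgebra.ιMulti_succ_apply]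
      congr 2
      ext1 i
      by_cases hi : i = k
      · subst hi; simp [Matrix.vecTail]
      · simp [Matrix.vecTail, hi]

theorem deltaPow_ιMulti (A : Module.End ℤ M) {r : ℕ} (u : Fin r → M) :
    deltaPow r A (exteriorPower.ιMulti ℤ r u) =
      ∑ k, exteriorPower.ιMulti ℤ r (Function.update u k (A (u k))) := by
  apply Subtype.ext
  rw [AddSubmonoidClass.coe_finsetSum]
  exact delta_ιMulti A u

/-! ### The generating function of the action on Schur determinants -/

/-- The matrix `(h_{λ_j-j+i})` with determinant `Δ_λ(H_r)`. -/
noncomputable def schurMatrix (r : ℕ) (lam : Fin r → ℕ) : Matrix (Fin r) (Fin r) (B r) :=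
  Matrix.of fun i j => h r ((lam j : ℤ) - (j : ℕ) + (i : ℕ))

theorem phi_symm_apply (r : ℕ) (v : ⋀[ℤ]^r M) : (phi r).symm v = schurMap r v := rfl

/-- The Leibniz rule gives one term per factor; a factor other than b_j is killed, and a factor b_j
is replaced by b_m. The adjugate form isolates the dependence on m, ready for summation against z^m.
-/
theorem glAct_elem_schur (r : ℕ) (lam : Fin r → ℕ) (m j : ℕ) :
    glAct r (elem m j) (schur r lam) = ∑ k : Fin r, if j = r - 1 - (k : ℕ) + lam k then
      ∑ i : Fin r, (schurMatrix r lam).adjugate k i * h r ((m : ℤ) - (r - 1) + (i : ℕ)) else 0 := by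
  rw [glAct, LinearMap.comp_apply, LinearMap.comp_apply, LinearEquiv.coe_coe, LinearEquiv.coe_coe,
    phi_schur, phi_symm_apply, bWedge, deltaPow_ιMulti, map_sum]
  refine Finset.sum_congr rfl fun k _ => ?_
  rw [elem_b]
  split_ifs with hj
  · have : ∑ i : Fin r, (schurMatrix r lam).adjugate k i * h r ((m : ℤ) - (r - 1) + (i : ℕ)) =
        ((schurMatrix r lam).updateCol k
          fun i : Fin r => h r ((m : ℤ) - (r - 1) + (i : ℕ))).det := by
      rw [← Matrix.cramer_apply, Matrix.cramer_eq_adjugate_mulVec]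
      rfl
    rw [this, schurMap, colDet_ιMulti]
    congr 1
    ext1 i l
    by_cases hl : l = k
    · subst hl; simp [b]
    · have := l.isLt
      simp only [b, Matrix.of_apply, ne_eq, hl, not_false_eq_true, Function.update_of_ne,
        Finsupp.linearCombination_single, one_smul, Matrix.updateCol_ne, schurMatrix]
      congr 1
      omega
  · rw [schurMap, colDet_ιMulti]
    exact Matrix.det_eq_zero_of_column_eq_zero k fun i => by simp

/-- A shift of the series 1/E_r(z). Because i ≤ n the shift is by a nonnegative power of z, and the
vanishing of h at negative indices supplies the coefficients below it. -/
theorem mk_h (n : ℕ) (i : Fin (n + 1)) :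
    (PowerSeries.mk fun m : ℕ => h (n + 1) ((m : ℤ) - n + (i : ℕ))) =
      PowerSeries.X ^ (n - (i : ℕ)) * invE (n + 1) := by
  ext1 m
  have := i.isLt
  rw [PowerSeries.coeff_mk, PowerSeries.coeff_X_pow_mul', h]
  split_ifs with h1 h2 h2
  · congr 2
    omega
  · omega
  · omega
  · rfl

theorem genE_schur_eq_mk (n : ℕ) (lam : Fin (n + 1) → ℕ) :
    genE (n + 1) (schur (n + 1) lam) =
      HahnSeries.ofPowerSeries ℤ _ (PowerSeries.mk fun m => ∑ k : Fin (n + 1),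
        ∑ i : Fin (n + 1), LaurentPolynomial.T (-((n : ℤ) - (k : ℕ) + lam k)) *
          LaurentPolynomial.C ((schurMatrix (n + 1) lam).adjugate k i) *
          LaurentPolynomial.C (h (n + 1) ((m : ℤ) - n + (i : ℕ)))) := by
  classical
  rw [genE]
  congr 2
  ext1 m
  set f : ℕ → LaurentPolynomial (B (n + 1)) := fun j =>
    LaurentPolynomial.C (glAct (n + 1) (elem m j) (schur (n + 1) lam)) *
      LaurentPolynomial.T (-(j : ℤ)) with hf
  set N : Fin (n + 1) → ℕ := fun k => n - (k : ℕ) + lam k with hN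
  -- Enlarging the support by the indices `N k` of the factors of the wedge ensures that, after
  -- exchanging the sums, each k meets its unique j, namely `N k`.
  rw [Finset.sum_subset (s₂ := (glAct_finite (n + 1) m (schur (n + 1) lam)).toFinset ∪
    Finset.univ.image N) (f := f) Finset.subset_union_left]
  · simp only [hf, glAct_elem_schur, map_sum, Finset.sum_mul]
    rw [Finset.sum_comm]
    refine Finset.sum_congr rfl fun k _ => ?_
    rw [Finset.sum_eq_single (N k)]
    · rw [if_pos (by simp [hN]), map_sum, Finset.sum_mul]
      refine Finset.sum_congr rfl fun i _ => ?_
      have hk := k.isLt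
      rw [map_mul, mul_comm, ← mul_assoc]
      congr 3
      · congr 1
        simp only [hN]
        omega
      · simp
    · intro j _ hj
      rw [if_neg (by simpa [hN] using hj)]
      simp
    · intro hk
      exact absurd (Finset.mem_union_right _ (Finset.mem_image_of_mem N (Finset.mem_univ k))) hk
  · intro j _ hj
    have : glAct (n + 1) (elem m j) (schur (n + 1) lam) = 0 := by simpa using hj
    simp [hf, this]

theorem zPow_add (r : ℕ) (a c : ℤ) : zPow r (a + c) = zPow r a * zPow r c := by
  simp [zPow]

theorem zPow_natCast (r m : ℕ) : zPow r m = HahnSeries.ofPowerSeries ℤ _ (PowerSeries.X ^ m) := by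
  simp [zPow, HahnSeries.ofPowerSeries_X_pow]

theorem zPow_neg_natCast (r m : ℕ) : zPow r (-(m : ℤ)) = zPow r (-1) ^ m := by
  induction m with
  | zero => simp [zPow]
  | succ m ih => rw [pow_succ, ← ih, ← zPow_add]; congr 1; push_cast; ring

theorem wPow_add (r : ℕ) (a c : ℤ) : wPow r (a + c) = wPow r a * wPow r c := by
  rw [wPow, LaurentPolynomial.T_add, map_mul]; rfl

/-- Splitting z^{n-i} as z^n z^{-i} and likewise the power of w extracts the common prefactor; this
is where negative powers of z enter. -/
theorem genE_schur_eq_sum (n : ℕ) (lam : Fin (n + 1) → ℕ) :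
    genE (n + 1) (schur (n + 1) lam) = zPow (n + 1) n * wPow (n + 1) (-n) * invEz (n + 1) *
      ∑ k : Fin (n + 1), wPow (n + 1) ((k : ℤ) - lam k) *
        ∑ i : Fin (n + 1), const (n + 1) ((schurMatrix (n + 1) lam).adjugate k i) *
          zPow (n + 1) (-1) ^ (i : ℕ) := by
  have key : (PowerSeries.mk fun m : ℕ => ∑ k : Fin (n + 1), ∑ i : Fin (n + 1),
        LaurentPolynomial.T (-((n : ℤ) - (k : ℕ) + lam k)) *
          LaurentPolynomial.C ((schurMatrix (n + 1) lam).adjugate k i) *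
          LaurentPolynomial.C (h (n + 1) ((m : ℤ) - n + (i : ℕ)))) =
      ∑ k : Fin (n + 1), ∑ i : Fin (n + 1),
        PowerSeries.C (LaurentPolynomial.T (-((n : ℤ) - (k : ℕ) + lam k))) *
          PowerSeries.C (LaurentPolynomial.C ((schurMatrix (n + 1) lam).adjugate k i)) *
          (PowerSeries.X ^ (n - (i : ℕ)) *
            PowerSeries.map LaurentPolynomial.C (invE (n + 1))) := by
    ext1 m
    rw [PowerSeries.coeff_mk, map_sum]
    refine Finset.sum_congr rfl fun k _ => ?_
    rw [map_sum]
    refine Finset.sum_congr rfl fun i _ => ?_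
    rw [← map_mul, PowerSeries.coeff_C_mul,
      show (PowerSeries.X : PowerSeries (LaurentPolynomial (B (n + 1)))) =
        PowerSeries.map LaurentPolynomial.C PowerSeries.X from (PowerSeries.map_X _).symm,
      ← map_pow, ← map_mul, ← mk_h, PowerSeries.coeff_map, PowerSeries.coeff_mk]
  rw [genE_schur_eq_mk, key, map_sum, Finset.mul_sum]
  refine Finset.sum_congr rfl fun k _ => ?_
  rw [map_sum, Finset.mul_sum, Finset.mul_sum]
  refine Finset.sum_congr rfl fun i _ => ?_
  have hi := i.isLt
  have h1 : HahnSeries.ofPowerSeries ℤ _ (PowerSeries.X ^ (n - (i : ℕ))) =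
      zPow (n + 1) n * zPow (n + 1) (-1) ^ (i : ℕ) := by
    rw [← zPow_natCast, ← zPow_neg_natCast, ← zPow_add]
    congr 1
    omega
  have h2 : wPow (n + 1) (-((n : ℤ) - (k : ℕ) + lam k)) =
      wPow (n + 1) (-n) * wPow (n + 1) ((k : ℤ) - lam k) := by
    rw [← wPow_add]
    congr 1
    ring
  rw [map_mul, map_mul, map_mul, h1, HahnSeries.ofPowerSeries_C, HahnSeries.ofPowerSeries_C]
  change wPow (n + 1) _ * const (n + 1) _ * (_ * invEz (n + 1)) = _
  rw [h2]
  ring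

/-- The matrix of `Δ_λ(w^{-λ}, σ̄_-(z) H_r)`. -/
noncomputable def barMatrix (r : ℕ) (lam : Fin r → ℕ) : Matrix (Fin r) (Fin r) (GenRing r) :=
  Matrix.of fun i j : Fin r => if (i : ℕ) = 0 then wPow r ((j : ℤ) - lam j)
    else hBar r ((lam j : ℤ) - (j : ℕ) + (i : ℕ))

theorem detWBar_eq_sum (n : ℕ) (lam : Fin (n + 1) → ℕ) :
    detWBar (n + 1) lam = ∑ k : Fin (n + 1), wPow (n + 1) ((k : ℤ) - lam k) *
      (barMatrix (n + 1) lam).adjugate k 0 := by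
  change (barMatrix (n + 1) lam).det = _
  rw [det_eq_sum_adjugate]
  rfl

theorem genE_schur_eq_detWBar (n : ℕ) (lam : Fin (n + 1) → ℕ) :
    genE (n + 1) (schur (n + 1) lam) =
      zPow (n + 1) n * wPow (n + 1) (-n) * invEz (n + 1) * detWBar (n + 1) lam := by
  rw [genE_schur_eq_sum, detWBar_eq_sum]
  refine congrArg _ (Finset.sum_congr rfl fun k _ => congrArg _ ?_)
  set A : Matrix (Fin (n + 1)) (Fin (n + 1)) (GenRing (n + 1)) :=
    (const (n + 1)).mapMatrix (schurMatrix (n + 1) lam) with hA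
  have h1 : ∀ i, const (n + 1) ((schurMatrix (n + 1) lam).adjugate k i) = A.adjugate k i := by
    intro i
    rw [hA, ← RingHom.map_adjugate]
    rfl
  simp only [h1]
  -- The row operations keep the first row of `A`, whereas `barMatrix` has powers of w there; the
  -- cofactors do not notice the exchange.
  rw [sum_adjugate_mul_pow (R := (barMatrix (n + 1) lam).updateRow 0 (A 0)) (zPow (n + 1) (-1))]
  · exact adjugate_zero_congr (fun i l => by simp) k
  · simp
  · intro i l
    rw [Matrix.updateRow_ne (Fin.succ_ne_zero i)]
    simp only [barMatrix, hA, schurMatrix, hBar, Matrix.of_apply, Fin.val_succ,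
      RingHom.mapMatrix_apply, Matrix.map_apply, Fin.val_castSucc, Nat.succ_ne_zero, if_false]
    rw [show (lam l : ℤ) - (l : ℕ) + ((i + 1 : ℕ) : ℤ) - 1 = (lam l : ℤ) - (l : ℕ) + (i : ℕ) by
      push_cast; ring]
    ring

theorem coeffZW_genE (r : ℕ) (P : B r) (i j : ℕ) :
    coeffZW r i (-j) (genE r P) = glAct r (elem i j) P := by
  rw [coeffZW, genE, HahnSeries.ofPowerSeries_apply_coeff, PowerSeries.coeff_mk]
  simp only [← LaurentPolynomial.single_eq_C_mul_T, AddMonoidAlgebra.coeff_sum,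
    AddMonoidAlgebra.coeff_single, Finsupp.finsetSum_apply, Finsupp.single_apply, neg_inj,
    Nat.cast_inj, Finset.sum_ite_eq']
  rw [ite_eq_left_iff]
  intro hj
  simpa [eq_comm] using hj

/-! ### The Schubert derivation on decomposable wedges and on cofactors -/

theorem prod_ofFn_monomial {A : Type*} [Ring A] {r : ℕ} (e : Fin r → ℕ) (a : Fin r → A) :
    (List.ofFn fun i => Polynomial.monomial (e i) (a i)).prod =
      Polynomial.monomial (∑ i, e i) (List.ofFn a).prod := by
  induction r with
  | zero => simp
  | succ r ih =>
    rw [List.ofFn_succ, List.prod_cons, ih, Polynomial.monomial_mul_monomial, List.ofFn_succ,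
      List.prod_cons, Fin.sum_univ_succ]

/-- Multiplying out the binomials u_l - z^{-1} `shiftDown` u_l: `s` records the factors that
contribute their shifted term. -/
theorem sigmaBarHom_ιMulti {r : ℕ} (u : Fin r → M) :
    sigmaBarHom (ExteriorAlgebra.ιMulti ℤ r u) = ∑ s : Finset (Fin r), Polynomial.monomial s.card
      (ExteriorAlgebra.ιMulti ℤ r (s.piecewise (fun l => -shiftDown (u l)) u)) := by
  have h1 : sigmaBarHom (ExteriorAlgebra.ιMulti ℤ r u) =
      MultilinearMap.mkPiAlgebraFin ℤ r (Polynomial (ExteriorAlgebra ℤ M))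
        ((fun l => Polynomial.monomial 1 (ExteriorAlgebra.ι ℤ (-shiftDown (u l)))) +
          fun l => Polynomial.monomial 0 (ExteriorAlgebra.ι ℤ (u l))) := by
    rw [MultilinearMap.mkPiAlgebraFin_apply, ExteriorAlgebra.ιMulti_apply, map_list_prod,
      List.map_ofFn]
    congr 2
    ext1 l
    rw [Function.comp_apply, sigmaBarHom_ι, Pi.add_apply, map_neg, map_neg, sub_eq_add_neg,
      add_comm]
    rfl
  rw [h1, MultilinearMap.map_add_univ]
  refine Finset.sum_congr rfl fun s _ => ?_
  rw [MultilinearMap.mkPiAlgebraFin_apply, ExteriorAlgebra.ιMulti_apply]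
  have h2 : s.card = ∑ i : Fin r, if i ∈ s then 1 else 0 := by simp
  rw [h2, ← prod_ofFn_monomial]
  congr 2
  ext1 l
  by_cases hl : l ∈ s <;> simp [hl]

theorem phi_schurMap (r : ℕ) (v : ⋀[ℤ]^r M) : phi r (schurMap r v) = v :=
  (phi r).apply_symm_apply v

theorem sigmaBarCoeff_ιMulti {r : ℕ} (k : ℕ) (u : Fin r → M) :
    sigmaBarCoeff r k (exteriorPower.ιMulti ℤ r u) = ∑ s : Finset (Fin r),
      if s.card = k then
        exteriorPower.ιMulti ℤ r (s.piecewise (fun l => -shiftDown (u l)) u) else 0 := by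
  apply Subtype.ext
  rw [AddSubmonoidClass.coe_finsetSum]
  change (sigmaBarHom (ExteriorAlgebra.ιMulti ℤ r u)).coeff k = _
  rw [sigmaBarHom_ιMulti, Polynomial.finsetSum_coeff]
  refine Finset.sum_congr rfl fun s _ => ?_
  rw [Polynomial.coeff_monomial]
  split_ifs <;> rfl

theorem sigmaBar_schurMap_ιMulti {r : ℕ} (u : Fin r → M) :
    sigmaBar r (schurMap r (exteriorPower.ιMulti ℤ r u)) = ∑ s : Finset (Fin r),
      const r (schurMap r
        (exteriorPower.ιMulti ℤ r (s.piecewise (fun l => -shiftDown (u l)) u))) *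
          zPow r (-(s.card : ℤ)) := by
  change ∑ k ∈ Finset.range (r + 1), const r ((phi r).symm (sigmaBarCoeff r k
    (phi r (schurMap r (exteriorPower.ιMulti ℤ r u))))) * zPow r (-(k : ℤ)) = _
  simp only [phi_schurMap, phi_symm_apply, sigmaBarCoeff_ιMulti, map_sum, Finset.sum_mul]
  rw [Finset.sum_comm]
  refine Finset.sum_congr rfl fun s _ => ?_
  -- A subset of `Fin r` has at most r elements, so the truncation in `sigmaBar` loses nothing.
  rw [Finset.sum_eq_single s.card, if_pos rfl]
  · intro k _ hk
    rw [if_neg hk.symm, map_zero, map_zero, zero_mul]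
  · intro hs
    have := s.card_le_univ
    rw [Fintype.card_fin] at this
    exact absurd (Finset.mem_range.2 (by omega)) hs

/-- `σ̄_-(z)` of a determinant is computed columnwise. -/
theorem sigmaBar_schurMap_eq_det {r : ℕ} (u : Fin r → M) :
    sigmaBar r (schurMap r (exteriorPower.ιMulti ℤ r u)) =
      (Matrix.of fun i l : Fin r =>
        const r (Finsupp.linearCombination ℤ
          (fun (n : ℕ) (i : Fin r) => h r ((n : ℤ) - (r - 1) + (i : ℕ))) (u l) i) -
        const r (Finsupp.linearCombination ℤ
          (fun (n : ℕ) (i : Fin r) => h r ((n : ℤ) - (r - 1) + (i : ℕ)))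
            (shiftDown (u l)) i) * zPow r (-1)).det := by
  set c : ℕ → Fin r → B r := fun n i => h r ((n : ℤ) - (r - 1) + (i : ℕ)) with hc
  set p : (Fin r → M) → Fin r → Fin r → GenRing r := fun u l i =>
    const r (Finsupp.linearCombination ℤ c (u l) i) with hp
  set t := zPow r (-1) with ht
  set D := (Matrix.detRowAlternating (n := Fin r) (R := GenRing r)).toMultilinearMap with hD
  have h1 : (Matrix.of fun i l : Fin r => const r (Finsupp.linearCombination ℤ c (u l) i) -
      const r (Finsupp.linearCombination ℤ c (shiftDown (u l)) i) * t).det =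
      D ((fun l => t • p (fun l => -shiftDown (u l)) l) + p u) := by
    rw [← Matrix.det_transpose]
    change _ = Matrix.det _
    congr 1
    ext1 l i
    simp only [hp, Matrix.transpose_apply, Matrix.of_apply, Pi.add_apply, Pi.smul_apply,
      smul_eq_mul, map_neg, Pi.neg_apply]
    ring
  -- Both sides now expand over the same subsets `s`; pulling `t` out of the columns in `s` yields
  -- z^{-|s|}.
  rw [h1, MultilinearMap.map_add_univ, sigmaBar_schurMap_ιMulti]
  refine Finset.sum_congr rfl fun s _ => ?_
  have h2 : s.piecewise (fun l => t • p (fun l => -shiftDown (u l)) l) (p u) =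
      s.piecewise (fun l => t • p (s.piecewise (fun l => -shiftDown (u l)) u) l)
        (p (s.piecewise (fun l => -shiftDown (u l)) u)) := by
    ext1 l
    by_cases hl : l ∈ s <;> simp [hl, hp]
  rw [h2, MultilinearMap.map_piecewise_smul, Finset.prod_const, zPow_neg_natCast, smul_eq_mul]
  refine (mul_comm (G := GenRing r) _ _).trans (congrArg (t ^ s.card * ·) ?_)
  rw [schurMap, colDet_ιMulti]
  refine (RingHom.map_det (n := Fin r) (R := B r) (S := GenRing r) (const r) _).trans ?_
  rw [← Matrix.det_transpose]
  rfl

theorem neg_one_pow_zsmul {S : Type*} [CommRing S] (n : ℕ) (x : S) :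
    (-1 : ℤ) ^ n • x = (-1) ^ n * x := by
  rw [zsmul_eq_mul, Int.cast_pow, Int.cast_neg, Int.cast_one]

/-- Raising the index of a basis vector by one moves its column up one row, and b_0 has the last
unit vector as column. So the cofactor is, up to (-1)^n, the image of the wedge with b_0 in slot k
and the other indices raised. As σ̄_-(z) fixes b_0, the result has the same shape and is read back
as a cofactor of `barMatrix`. -/
theorem sigmaBar_adjugate (n : ℕ) (lam : Fin (n + 1) → ℕ) (k : Fin (n + 1)) :
    sigmaBar (n + 1) ((schurMatrix (n + 1) lam).adjugate k 0) =
      (barMatrix (n + 1) lam).adjugate k 0 := by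
  set m : Fin (n + 1) → ℕ := fun l => if l = k then 0 else n - (l : ℕ) + lam l + 1 with hm
  have hlast (i : Fin (n + 1)) : h (n + 1) (-(n : ℤ) + (i : ℕ)) =
      if i = Fin.last n then 1 else 0 := by
    split_ifs with hi
    · rw [hi, Fin.val_last, neg_add_cancel, h_zero]
    · have h1 := i.isLt
      have h2 : (i : ℕ) ≠ n := fun h => hi (Fin.ext h)
      exact h_neg _ (by omega)
  have h1 : (schurMatrix (n + 1) lam).adjugate k 0 =
      (-1 : ℤ) ^ n • schurMap (n + 1) (exteriorPower.ιMulti ℤ (n + 1) fun l => b (m l)) := by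
    rw [schurMap, colDet_b, neg_one_pow_zsmul]
    refine adjugate_zero_eq_det k (fun i => ?_) fun i l hl => ?_
    · rw [← hlast]
      simp [hm]
    · have := l.isLt
      simp only [hm, hl, if_false, schurMatrix, Matrix.of_apply, Fin.val_castSucc, Fin.val_succ]
      congr 1
      omega
  rw [h1, map_zsmul, sigmaBar_schurMap_eq_det]
  refine (neg_one_pow_zsmul (S := GenRing (n + 1)) n _).trans (Eq.symm ?_)
  -- `shiftDown` kills b_0, so column k is still the last unit vector and the same reduction applies
  -- over `GenRing`.
  refine adjugate_zero_eq_det k (fun i => ?_) fun i l hl => ?_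
  · have := hlast i
    simp only [Matrix.of_apply, hm, if_true, shiftDown, b, Finsupp.linearCombination_single]
    simp only [Nat.cast_zero, Nat.cast_add, Nat.cast_one, add_sub_cancel_right, zero_sub, this,
      one_smul, map_zero, Pi.zero_apply, zero_mul, apply_ite (const (n + 1)),
      map_one]
    exact sub_zero (G := GenRing (n + 1)) _
  · have := l.isLt
    simp only [Matrix.of_apply, hm, hl, if_false, shiftDown, b, Finsupp.linearCombination_single,
      one_smul, Nat.succ_ne_zero, barMatrix, Fin.val_castSucc, Fin.val_succ, hBar,
      Nat.add_sub_cancel]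
    rw [show ((n - (l : ℕ) + lam l + 1 : ℕ) : ℤ) - ((n + 1 : ℕ) - 1) + (i : ℕ) =
        (lam l : ℤ) - (l : ℕ) + (i + 1 : ℕ) by omega,
      show ((n - (l : ℕ) + lam l : ℕ) : ℤ) - ((n + 1 : ℕ) - 1) + (i : ℕ) =
        (lam l : ℤ) - (l : ℕ) + (i + 1 : ℕ) - 1 by omega]

/-! ### Extension to Laurent polynomials in w -/

theorem sigmaBarW_add (r : ℕ) (F G : LaurentPolynomial (B r)) :
    sigmaBarW r (F + G) = sigmaBarW r F + sigmaBarW r G := by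
  rw [sigmaBarW, AddMonoidAlgebra.coeff_add, Finsupp.sum_add_index']
  · rfl
  · simp
  · simp [mul_add]

theorem sigmaBarW_sum (r : ℕ) {ι : Type*} (s : Finset ι) (F : ι → LaurentPolynomial (B r)) :
    sigmaBarW r (∑ k ∈ s, F k) = ∑ k ∈ s, sigmaBarW r (F k) :=
  map_sum (⟨⟨sigmaBarW r, by simp [sigmaBarW]⟩, sigmaBarW_add r⟩ :
    LaurentPolynomial (B r) →+ GenRing r) F s

theorem sigmaBarW_T_mul_C (r : ℕ) (a : ℤ) (P : B r) :
    sigmaBarW r (LaurentPolynomial.T a * LaurentPolynomial.C P) = wPow r a * sigmaBar r P := by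
  rw [mul_comm, ← LaurentPolynomial.single_eq_C_mul_T, sigmaBarW, AddMonoidAlgebra.coeff_single,
    Finsupp.sum_single_index]
  simp

/-- Expansion along the first row makes each term a monomial in w times a cofactor in B_r, so
additivity and `sigmaBar_adjugate` suffice although `sigmaBarW` is not a ring map. -/
theorem sigmaBarW_detW (n : ℕ) (lam : Fin (n + 1) → ℕ) :
    sigmaBarW (n + 1) (detW (n + 1) lam) = detWBar (n + 1) lam := by
  rw [detW, det_eq_sum_adjugate, sigmaBarW_sum, detWBar_eq_sum]
  refine Finset.sum_congr rfl fun k _ => ?_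
  rw [← sigmaBar_adjugate, ← sigmaBarW_T_mul_C]
  congr 2
  have : LaurentPolynomial.C ((schurMatrix (n + 1) lam).adjugate k 0) =
      (LaurentPolynomial.C.mapMatrix (schurMatrix (n + 1) lam)).adjugate k 0 := by
    rw [← RingHom.map_adjugate]
    rfl
  rw [this]
  exact adjugate_zero_congr (fun i l => by simp [schurMatrix]) k

end Grass

open Grass
theorem theorem4p3 (r : ℕ) (hr : 1 ≤ r) (lam : Fin r → ℕ) (hlam : Antitone lam) :
    genE r (schur r lam) =
        zPow r (r - 1) * wPow r (-(r - 1)) * invEz r * sigmaBarW r (detW r lam) ∧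
      genE r (schur r lam) =
        zPow r (r - 1) * wPow r (-(r - 1)) * invEz r * detWBar r lam ∧
      ∀ i j : ℕ, glAct r (elem i j) (schur r lam) =
        coeffZW r i (-j)
          (zPow r (r - 1) * wPow r (-(r - 1)) * invEz r * detWBar r lam) := by
  obtain ⟨n, rfl⟩ : ∃ n, r = n + 1 := ⟨r - 1, by omega⟩
  have hn : (((n + 1 : ℕ) : ℤ) - 1) = n := by push_cast; ring
  have h1 := genE_schur_eq_detWBar n lam
  rw [hn, sigmaBarW_detW, ← h1]
  exact ⟨rfl, rfl, fun i j => (coeffZW_genE (n + 1) _ i j).symm⟩
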